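/- Let $d\ge 1$ and $\alpha\in(0,2]$. A geometric $\alpha$-stable process on $\mathbb R^d$ is a Lévy process $L=(L_t)_{t\ge0}$ started at $0$, defined on some probability space, with symbol $\psi(\xi)=\log(1+|\xi|^\alpha)$, that is, $\mathbb E[e^{i\langle \xi,L_t\rangle}]=e^{-t\psi(\xi)}=(1+|\xi|^\alpha)^{-t}$ for all $t\ge0$ and $\xi\in\mathbb R^d$. For $x\in\mathbb R^d$ put $X_t=x+L_t$. Then the geometric $\alpha$-stable process has a transition density with respect to Lebesgue measure: there are nonnegative Borel functions $p_t$, $t>0$, on $\mathbb R^d$ such that for every $t>0$ 1. $p_t(y)\,dy$ is a probability measure with Fourier transform $\xi\mapsto(1+|\xi|^\alpha)^{-t}$, and 2. for every geometric $\alpha$-stable process $L$ and every $x\in\mathbb R^d$, the law of $X_t=x+L_t$ is $p_t(y-x)\,dy$. This includes the times $0<t\le d/\alpha$, for which the characteristic function $\xi\mapsto(1+|\xi|^\alpha)^{-t}$ is not integrable on $\mathbb R^d$. -/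

import Mathlib

open MeasureTheory ProbabilityTheory Filter Topology
open scoped NNReal ENNReal

/-- A process `L` indexed by `[0, ∞)`, with values in `ℝ^d`, is a Lévy process starting at `0` on
the probability space `(Ω, P)`: the increments are independent and stationary, the process starts
at `0`, is continuous in probability, and almost every path is right continuous with left limits
(at time `0` the left-limit condition is trivial). -/
structure IsLevyProcess {d : ℕ} {Ω : Type*} [MeasurableSpace Ω]
    (L : ℝ≥0 → Ω → EuclideanSpace ℝ (Fin d)) (P : Measure Ω) : Prop where
  isProbabilityMeasure : IsProbabilityMeasure P
  measurable : ∀ t, Measurable (L t)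
  start : ∀ᵐ ω ∂P, L 0 ω = 0
  indep_increments : HasIndepIncrements L P
  stationary_increments : ∀ s h,
    IdentDistrib (fun ω ↦ L (s + h) ω - L s ω) (fun ω ↦ L h ω - L 0 ω) P P
  continuous_in_measure : ∀ t, TendstoInMeasure P L (𝓝 t) (L t)
  cadlag : ∀ᵐ ω ∂P, ∀ t, ContinuousWithinAt (fun s ↦ L s ω) (Set.Ici t) t ∧
    ∃ l, Tendsto (fun s ↦ L s ω) (𝓝[<] t) (𝓝 l)

/-- `ψ` is the symbol (characteristic exponent) of `L`:
`E[exp(i⟨ξ, L_t⟩)] = exp(-t ψ(ξ))` for all `t ≥ 0` and `ξ`. -/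
def HasSymbol {d : ℕ} {Ω : Type*} [MeasurableSpace Ω]
    (L : ℝ≥0 → Ω → EuclideanSpace ℝ (Fin d)) (P : Measure Ω)
    (ψ : EuclideanSpace ℝ (Fin d) → ℂ) : Prop :=
  ∀ (t : ℝ≥0) (ξ : EuclideanSpace ℝ (Fin d)),
    charFun (P.map (L t)) ξ = Complex.exp (-((t : ℝ) : ℂ) * ψ ξ)

/-- The symbol `ψ(ξ) = log(1 + |ξ|^α)`. -/
noncomputable def geometricStableSymbol (d : ℕ) (α : ℝ) (ξ : EuclideanSpace ℝ (Fin d)) : ℝ :=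
  Real.log (1 + ‖ξ‖ ^ α)

/-- `L` is a geometric `α`-stable process on `ℝ^d`, started at `0`. -/
structure IsGeometricStableProcess {d : ℕ} {Ω : Type*} [MeasurableSpace Ω] (α : ℝ)
    (L : ℝ≥0 → Ω → EuclideanSpace ℝ (Fin d)) (P : Measure Ω) : Prop where
  isLevyProcess : IsLevyProcess L P
  hasSymbol : HasSymbol L P (fun ξ ↦ (geometricStableSymbol d α ξ : ℂ))

/-! The proof subordinates a Gaussian instead of inverting a Fourier transform. With `b = α / 2`,
let `G` be Gamma of shape `t`, `S` one-sided `b`-stable and `Z` standard Gaussian, all independent,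
and put `T = G ^ (1 / b) * S`. Conditioning on `G`, `T` has Laplace transform `(1 + l ^ b) ^ (-t)`
(`exists_laplace_one_add_rpow`). Hence `√(2 * T) • Z` has characteristic function `(1 + ‖ξ‖ ^ α) ^
(-t)`. Since `T > 0` almost surely, this is a mixture of nondegenerate Gaussians, so it has a
density for every `t > 0`, whether or not the characteristic function is integrable. Characteristic
functions determine laws, so this is the law of `L t`.

The stable law (`exists_laplace_exp_neg_rpow`) is obtained as a limit of normalized Pareto sums, by
compactness. -/

/-- The standard Gaussian measure has a density with respect to Lebesgue measure. -/
lemma stdGaussian_absolutelyContinuous {E : Type*} [NormedAddCommGroup E] [InnerProductSpace ℝ E]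
    [FiniteDimensional ℝ E] [MeasurableSpace E] [BorelSpace E] :
    stdGaussian E ≪ (volume : Measure E) := by
  set g : E → ℝ := fun v ↦ Real.exp (-(1 / 2) * ‖v‖ ^ 2) with hg
  have hI : Integrable g := by
    -- The Bochner integral of a non-integrable function is `0` by convention, so a nonzero value
    -- proves integrability.
    refine Integrable.of_integral_ne_zero ?_
    rw [hg, GaussianFourier.integral_rexp_neg_mul_sq_norm (by norm_num)]
    positivity
  have hgm : Measurable g := by fun_prop
  set γ : Measure E := volume.withDensity (fun v ↦ ENNReal.ofReal (g v)) with hγ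
  have : IsFiniteMeasure γ := isFiniteMeasure_withDensity_ofReal hI.2
  set c : ℝ≥0 := Real.toNNReal ((2 * Real.pi) ^ (Module.finrank ℝ E / 2 : ℝ)) with hc
  have hc0 : c ≠ 0 := by
    rw [hc, ne_eq, Real.toNNReal_eq_zero, not_le]
    positivity
  have h : γ = c • stdGaussian E := by
    refine Measure.ext_of_charFun (funext fun ξ ↦ ?_)
    have h1 : charFun γ ξ = ∫ v : E, Complex.exp (-(1 / 2 : ℂ) * ‖v‖ ^ 2 +
        Complex.I * inner ℝ ξ v) := by
      rw [charFun_apply, hγ, integral_withDensity_eq_integral_toReal_smul (by fun_prop)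
        (ae_of_all _ fun _ ↦ ENNReal.ofReal_lt_top)]
      refine integral_congr_ae (ae_of_all _ fun v ↦ ?_)
      simp only [hg]
      rw [ENNReal.toReal_ofReal (Real.exp_nonneg _), Complex.real_smul, Complex.ofReal_exp,
        ← Complex.exp_add, real_inner_comm]
      push_cast
      ring_nf
    rw [h1, GaussianFourier.integral_cexp_neg_mul_sq_norm_add (by norm_num), charFun_apply,
      integral_smul_nnreal_measure, ← charFun_apply, charFun_stdGaussian, NNReal.smul_def,
      hc, Real.coe_toNNReal _ (by positivity), Complex.real_smul,
      Complex.ofReal_cpow (by positivity)]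
    push_cast
    congr 2
    · ring
    · rw [Complex.I_sq]; ring
  have h2 : stdGaussian E ≪ γ := by
    rw [h]
    exact Measure.absolutelyContinuous_smul (ENNReal.coe_ne_zero.2 hc0)
  exact h2.trans (withDensity_absolutelyContinuous _ _)

/-- `(1 + ‖ξ‖ ^ α) ^ (-t)` decays too slowly to be integrable when `t ≤ d / α`. -/
lemma not_integrable_one_add_norm_rpow {E : Type*} [NormedAddCommGroup E] [InnerProductSpace ℝ E]
    [FiniteDimensional ℝ E] [MeasurableSpace E] [BorelSpace E] [Nontrivial E]
    {α t : ℝ} (hα : 0 < α) (ht : 0 ≤ t) (h : t ≤ Module.finrank ℝ E / α) :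
    ¬ Integrable (fun ξ : E ↦ (1 + ‖ξ‖ ^ α) ^ (-t)) := by
  intro hI
  have h1 := (integrable_fun_norm_addHaar (volume : Measure E)
    (f := fun r : ℝ ↦ (1 + r ^ α) ^ (-t))).1 hI
  -- In polar coordinates the integrand is at least a constant times `y ^ (dim - 1 - α * t)`, with
  -- exponent at least `-1`; this would make `1 / y` integrable at infinity.
  have h2 : IntegrableOn (fun y : ℝ ↦ y ^ (-1 : ℝ)) (Set.Ioi 1) := by
    refine Integrable.mono' ((h1.mono_set (Set.Ioi_subset_Ioi zero_le_one)).const_mul (2 ^ t))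
      (by fun_prop) ?_
    filter_upwards [ae_restrict_mem measurableSet_Ioi] with y (hy : 1 < y)
    have hy0 : 0 < y := by linarith
    rw [Real.norm_of_nonneg (by positivity), smul_eq_mul, ← Real.rpow_natCast,
      Nat.cast_sub Module.finrank_pos, Nat.cast_one]
    have h3 : 1 + y ^ α ≤ 2 * y ^ α := by
      linarith [Real.one_le_rpow hy.le hα.le]
    have h4 : (2 * y ^ α) ^ (-t) ≤ (1 + y ^ α) ^ (-t) :=
      Real.rpow_le_rpow_of_nonpos (by positivity) h3 (by linarith)
    have h5 : y ^ (-1 : ℝ) ≤ y ^ ((Module.finrank ℝ E : ℝ) - 1 + α * (-t)) := by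
      refine Real.rpow_le_rpow_of_exponent_le hy.le ?_
      rw [le_div_iff₀ hα] at h
      linarith
    calc y ^ (-1 : ℝ) ≤ y ^ ((Module.finrank ℝ E : ℝ) - 1 + α * (-t)) := h5
      _ = 2 ^ t * (y ^ ((Module.finrank ℝ E : ℝ) - 1) * (2 * y ^ α) ^ (-t)) := by
        rw [Real.mul_rpow zero_le_two (by positivity), ← Real.rpow_mul hy0.le,
          Real.rpow_add hy0, Real.rpow_neg zero_le_two]
        field_simp
      _ ≤ _ := by gcongr
  rw [integrableOn_Ioi_rpow_iff zero_lt_one] at h2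
  exact lt_irrefl _ h2

/-! ### Gaussian scale mixtures. -/

/-- A scale mixture of Gaussian measures with mixing measure `m` on the positive reals. -/
lemma charFun_map_sqrt_smul_stdGaussian {E : Type*} [NormedAddCommGroup E] [InnerProductSpace ℝ E]
    [FiniteDimensional ℝ E] [MeasurableSpace E] [BorelSpace E] (m : Measure ℝ)
    [IsProbabilityMeasure m] (hm : ∀ᵐ u ∂m, 0 < u) (ξ : E) :
    charFun ((m.prod (stdGaussian E)).map (fun q ↦ √(2 * q.1) • q.2)) ξ =
      ((∫ u, Real.exp (-(‖ξ‖ ^ 2 * u)) ∂m : ℝ) : ℂ) := by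
  have hmeas : Measurable (fun q : ℝ × E ↦ √(2 * q.1) • q.2) := by fun_prop
  rw [charFun_apply, integral_map hmeas.aemeasurable (by fun_prop), integral_prod,
    ← integral_complex_ofReal]
  · refine integral_congr_ae ?_
    filter_upwards [hm] with u hu
    have : ∫ z, Complex.exp (inner ℝ (√(2 * u) • z) ξ * Complex.I) ∂(stdGaussian E) =
        charFun (stdGaussian E) (√(2 * u) • ξ) := by
      simp_rw [charFun_apply, real_inner_smul_left, real_inner_smul_right]
    rw [this, charFun_stdGaussian, norm_smul, Real.norm_of_nonneg (Real.sqrt_nonneg _)]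
    rw [Complex.ofReal_exp, ← Complex.ofReal_pow, mul_pow, Real.sq_sqrt (by positivity)]
    push_cast
    ring_nf
  · refine Integrable.of_bound (C := 1) (by fun_prop) (ae_of_all _ fun q ↦ ?_)
    rw [Complex.norm_exp_ofReal_mul_I]

/-- By Fubini it suffices to fix `u > 0`, and a dilation by a nonzero factor preserves Lebesgue null
sets. -/
lemma map_sqrt_smul_stdGaussian_absolutelyContinuous {E : Type*} [NormedAddCommGroup E]
    [InnerProductSpace ℝ E] [FiniteDimensional ℝ E] [MeasurableSpace E] [BorelSpace E]
    (m : Measure ℝ) [IsProbabilityMeasure m] (hm : ∀ᵐ u ∂m, 0 < u) :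
    (m.prod (stdGaussian E)).map (fun q ↦ √(2 * q.1) • q.2) ≪ (volume : Measure E) := by
  have hmeas : Measurable (fun q : ℝ × E ↦ √(2 * q.1) • q.2) := by fun_prop
  refine Measure.AbsolutelyContinuous.mk fun s hs hs0 ↦ ?_
  rw [Measure.map_apply hmeas hs, Measure.measure_prod_null (hmeas hs)]
  filter_upwards [hm] with u hu
  refine stdGaussian_absolutelyContinuous ?_
  have hc : √(2 * u) ≠ 0 := by positivity
  change volume ((fun z : E ↦ √(2 * u) • z) ⁻¹' s) = 0
  rw [Measure.addHaar_preimage_smul _ hc, hs0, mul_zero]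

/-! ### Gamma randomization of the stable law. -/

lemma measurable_gammaPDF (a r : ℝ) : Measurable (gammaPDF a r) :=
  (measurable_gammaPDFReal a r).ennreal_ofReal

/-- If `G` has the Gamma distribution of shape `t` and `S` has the one-sided `b`-stable
distribution, then `G ^ (1 / b) * S` has Laplace transform `(1 + l ^ b) ^ (-t)`. -/
lemma exists_laplace_one_add_rpow {b : ℝ} (hb : 0 < b) {t : ℝ} (ht : 0 < t)
    (σ : Measure ℝ) [IsProbabilityMeasure σ] (hσ : ∀ᵐ u ∂σ, 0 < u)
    (hL : ∀ l, 0 ≤ l → ∫ u, Real.exp (-(l * u)) ∂σ = Real.exp (-l ^ b)) :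
    ∃ m : Measure ℝ, IsProbabilityMeasure m ∧ (∀ᵐ u ∂m, 0 < u) ∧
      ∀ l, 0 ≤ l → ∫ u, Real.exp (-(l * u)) ∂m = (1 + l ^ b) ^ (-t) := by
  have := isProbabilityMeasure_gammaMeasure ht zero_lt_one
  set κ := gammaMeasure t 1 with hκ
  have hκ0 : ∀ᵐ s ∂κ, 0 < s := by
    rw [hκ, gammaMeasure, ae_withDensity_iff (measurable_gammaPDF t 1)]
    filter_upwards [Measure.ae_ne volume (0 : ℝ)] with s hs hs'
    by_contra h
    exact hs' (gammaPDF_of_neg (lt_of_le_of_ne (not_lt.1 h) hs))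
  have hmeas : Measurable (fun q : ℝ × ℝ ↦ q.1 ^ (1 / b) * q.2) := by fun_prop
  have hpos : ∀ᵐ q ∂(κ.prod σ), 0 < q.1 ^ (1 / b) * q.2 := by
    have h1 : ∀ᵐ q ∂(κ.prod σ), 0 < q.1 := Measure.quasiMeasurePreserving_fst.ae hκ0
    have h2 : ∀ᵐ q ∂(κ.prod σ), 0 < q.2 := Measure.quasiMeasurePreserving_snd.ae hσ
    filter_upwards [h1, h2] with q h1 h2
    positivity
  refine ⟨(κ.prod σ).map (fun q ↦ q.1 ^ (1 / b) * q.2),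
    Measure.isProbabilityMeasure_map hmeas.aemeasurable, ?_, fun l hl ↦ ?_⟩
  · rwa [ae_map_iff hmeas.aemeasurable measurableSet_Ioi]
  rw [integral_map hmeas.aemeasurable (by fun_prop), integral_prod]
  · have h1 : ∀ᵐ s ∂κ, ∫ u, Real.exp (-(l * (s ^ (1 / b) * u))) ∂σ = Real.exp (-(l ^ b * s)) := by
      filter_upwards [hκ0] with s hs
      simp_rw [← mul_assoc]
      rw [hL _ (by positivity), Real.mul_rpow hl (by positivity), ← Real.rpow_mul hs.le,
        one_div_mul_cancel hb.ne', Real.rpow_one]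
    rw [integral_congr_ae h1, hκ, gammaMeasure, integral_withDensity_eq_integral_toReal_smul
      (measurable_gammaPDF t 1) (ae_of_all _ fun _ ↦ ENNReal.ofReal_lt_top),
      ← setIntegral_eq_integral_of_ae_compl_eq_zero (s := Set.Ioi 0)]
    · have h2 : ∀ s ∈ Set.Ioi (0 : ℝ), (gammaPDF t 1 s).toReal • Real.exp (-(l ^ b * s)) =
          (Real.Gamma t)⁻¹ * (s ^ (t - 1) * Real.exp (-((1 + l ^ b) * s))) := by
        intro s hs
        have hs : 0 < s := hs
        have : 0 < Real.Gamma t := Real.Gamma_pos_of_pos ht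
        rw [gammaPDF_of_nonneg hs.le, ENNReal.toReal_ofReal (by positivity), Real.one_rpow,
          smul_eq_mul, mul_assoc, mul_assoc, ← Real.exp_add]
        ring_nf
      rw [setIntegral_congr_fun measurableSet_Ioi h2, integral_const_mul,
        Real.integral_rpow_mul_exp_neg_mul_Ioi ht (by positivity), one_div, Real.inv_rpow
        (by positivity), Real.rpow_neg (by positivity)]
      field_simp [(Real.Gamma_pos_of_pos ht).ne']
    · filter_upwards [Measure.ae_ne volume (0 : ℝ)] with s hs hs'
      rw [gammaPDF_of_neg (lt_of_le_of_ne (not_lt.1 hs') hs)]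
      simp
  · refine Integrable.of_bound (C := 1) (by fun_prop) ?_
    filter_upwards [hpos] with q hq
    rw [Real.norm_of_nonneg (Real.exp_nonneg _), Real.exp_le_one_iff]
    nlinarith

/-! ### The Lévy integral of the one-sided stable law. -/

/-- The Lévy density of the one-sided `b`-stable law integrates `1 - exp (-l * x)`. -/
lemma integrableOn_one_sub_exp_mul_rpow {b : ℝ} (hb : 0 < b) (hb1 : b < 1) {l : ℝ} (hl : 0 ≤ l) :
    IntegrableOn (fun x : ℝ ↦ (1 - Real.exp (-(l * x))) * x ^ (-(b + 1))) (Set.Ioi 0) := by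
  -- Near `0`, `1 - exp (-l * x) ≤ l * x` leaves `x ^ (-b)`, integrable as `b < 1`; beyond `1`, `x ^
  -- (-(b + 1))` is integrable as `b > 0`.
  rw [← Set.Ioc_union_Ioi_eq_Ioi zero_le_one, integrableOn_union]
  constructor
  · have h1 : IntegrableOn (fun x : ℝ ↦ x ^ (-b)) (Set.Ioc 0 1) :=
      (intervalIntegrable_iff_integrableOn_Ioc_of_le zero_le_one).1
        (intervalIntegral.intervalIntegrable_rpow' (by linarith))
    refine Integrable.mono' (h1.const_mul l) (by fun_prop) ?_
    filter_upwards [ae_restrict_mem measurableSet_Ioc] with x hx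
    have hx0 : 0 < x := hx.1
    have h2 : Real.exp (-(l * x)) ≤ 1 := Real.exp_le_one_iff.2 (by nlinarith)
    rw [Real.norm_of_nonneg (mul_nonneg (by linarith) (by positivity))]
    calc (1 - Real.exp (-(l * x))) * x ^ (-(b + 1)) ≤ l * x * x ^ (-(b + 1)) := by
          gcongr
          linarith [Real.add_one_le_exp (-(l * x))]
      _ = l * x ^ (-b) := by
          rw [mul_assoc, ← Real.rpow_one_add' hx0.le (by linarith)]
          ring_nf
  · refine Integrable.mono' (integrableOn_Ioi_rpow_of_lt (a := -(b + 1)) (by linarith) zero_lt_one)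
      (by fun_prop) ?_
    filter_upwards [ae_restrict_mem measurableSet_Ioi] with x (hx : 1 < x)
    have hx0 : 0 < x := by linarith
    have h2 : Real.exp (-(l * x)) ≤ 1 := Real.exp_le_one_iff.2 (by nlinarith)
    rw [Real.norm_of_nonneg (mul_nonneg (by linarith) (by positivity))]
    exact mul_le_of_le_one_left (by positivity) (by linarith [Real.exp_pos (-(l * x))])

/-- The total jump intensity `∫ (1 - exp (-l * x)) b x ^ (-(b + 1)) dx` scales as `l ^ b`. -/
lemma integral_one_sub_exp_mul_rpow {b : ℝ} (hb : 0 < b) {l : ℝ} (hl : 0 ≤ l) :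
    ∫ x in Set.Ioi (0 : ℝ), (1 - Real.exp (-(l * x))) * x ^ (-(b + 1)) =
      l ^ b * ∫ x in Set.Ioi (0 : ℝ), (1 - Real.exp (-x)) * x ^ (-(b + 1)) := by
  rcases hl.eq_or_lt with rfl | hl
  · simp [Real.zero_rpow hb.ne']
  have h := integral_comp_mul_left_Ioi
    (fun x : ℝ ↦ (1 - Real.exp (-x)) * x ^ (-(b + 1))) 0 hl
  rw [mul_zero, smul_eq_mul, eq_inv_mul_iff_mul_eq₀ hl.ne'] at h
  rw [← h, ← mul_assoc, ← integral_const_mul]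
  refine setIntegral_congr_fun measurableSet_Ioi fun x hx ↦ ?_
  have hx : 0 < x := hx
  rw [Real.mul_rpow hl.le hx.le]
  have : l ^ b * l * l ^ (-(b + 1)) = 1 := by
    rw [← Real.rpow_add_one hl.ne', ← Real.rpow_add hl]
    simp
  linear_combination (-(1 - Real.exp (-(l * x))) * x ^ (-(b + 1))) * this

lemma integral_one_sub_exp_mul_rpow_pos {b : ℝ} (hb : 0 < b) (hb1 : b < 1) :
    0 < ∫ x in Set.Ioi (0 : ℝ), (1 - Real.exp (-x)) * x ^ (-(b + 1)) := by
  have hI := integrableOn_one_sub_exp_mul_rpow hb hb1 zero_le_one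
  simp only [one_mul] at hI
  have hpos : ∀ x ∈ Set.Ioi (0 : ℝ), 0 < (1 - Real.exp (-x)) * x ^ (-(b + 1)) := by
    intro x hx
    have hx : 0 < x := hx
    have : Real.exp (-x) < 1 := by
      rw [← Real.exp_zero]
      exact Real.exp_lt_exp.2 (by linarith)
    exact mul_pos (by linarith) (by positivity)
  rw [setIntegral_pos_iff_support_of_nonneg_ae
    ((ae_restrict_iff' measurableSet_Ioi).2 (ae_of_all _ fun x hx ↦ (hpos x hx).le)) hI]
  refine lt_of_lt_of_le ?_ (measure_mono (s := Set.Ioi (0 : ℝ))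
    fun x hx ↦ ⟨(hpos x hx).ne', hx⟩)
  simp

/-! ### Pareto approximation of the stable law. -/

lemma measurable_paretoPDF (r b : ℝ) : Measurable (paretoPDF r b) :=
  (measurable_paretoPDFReal r b).ennreal_ofReal

lemma ae_paretoMeasure_pos {r b : ℝ} (hr : 0 < r) : ∀ᵐ x ∂(paretoMeasure r b), 0 < x := by
  rw [paretoMeasure, ae_withDensity_iff (measurable_paretoPDF r b)]
  refine ae_of_all _ fun x hx ↦ ?_
  by_contra h
  exact hx (paretoPDF_of_lt (by linarith))

lemma integrable_exp_neg_mul_of_ae_pos {μ : Measure ℝ} [IsFiniteMeasure μ]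
    (hμ : ∀ᵐ x ∂μ, 0 < x) {l : ℝ} (hl : 0 ≤ l) :
    Integrable (fun x ↦ Real.exp (-(l * x))) μ := by
  refine Integrable.of_bound (C := 1) (by fun_prop) ?_
  filter_upwards [hμ] with x hx
  rw [Real.norm_of_nonneg (Real.exp_nonneg _), Real.exp_le_one_iff]
  nlinarith

/-- Subtracting from the total mass `1` exposes the Lévy integral truncated at `r`, which converges
as `r → 0`. -/
lemma integral_exp_neg_mul_paretoMeasure {r b : ℝ} (hr : 0 < r) (hb : 0 < b) {l : ℝ} (hl : 0 ≤ l) :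
    ∫ x, Real.exp (-(l * x)) ∂(paretoMeasure r b) =
      1 - b * r ^ b * ∫ x in Set.Ioi r, (1 - Real.exp (-(l * x))) * x ^ (-(b + 1)) := by
  have := isProbabilityMeasure_paretoMeasure hr hb
  have h1 : ∫ x, (1 - Real.exp (-(l * x))) ∂(paretoMeasure r b) =
      b * r ^ b * ∫ x in Set.Ioi r, (1 - Real.exp (-(l * x))) * x ^ (-(b + 1)) := by
    rw [paretoMeasure, integral_withDensity_eq_integral_toReal_smul
      (measurable_paretoPDF r b) (ae_of_all _ fun _ ↦ ENNReal.ofReal_lt_top),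
      ← setIntegral_eq_integral_of_ae_compl_eq_zero (s := Set.Ioi r), ← integral_const_mul]
    · refine setIntegral_congr_fun measurableSet_Ioi fun x hx ↦ ?_
      have hx : r < x := hx
      have hx0 : 0 < x := hr.trans hx
      rw [paretoPDF_of_le hx.le, ENNReal.toReal_ofReal (by positivity), smul_eq_mul]
      ring
    · filter_upwards [Measure.ae_ne volume r] with x hx hx'
      rw [paretoPDF_of_lt (lt_of_le_of_ne (not_lt.1 hx') hx)]
      simp
  rw [integral_sub (integrable_const _)
    (integrable_exp_neg_mul_of_ae_pos (ae_paretoMeasure_pos hr) hl)] at h1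
  simp only [integral_const, probReal_univ, smul_eq_mul, mul_one] at h1
  linarith

/-- The Laplace transforms of normalized sums of independent Pareto variables converge. -/
lemma tendsto_integral_exp_paretoMeasure_pow {b : ℝ} (hb : 0 < b) (hb1 : b < 1) {l : ℝ}
    (hl : 0 ≤ l) :
    Tendsto (fun n : ℕ ↦
      (∫ x, Real.exp (-(l * x)) ∂(paretoMeasure ((n : ℝ) ^ (-(1 / b))) b)) ^ n) atTop
      (𝓝 (Real.exp (-(b * (l ^ b *
        ∫ x in Set.Ioi (0 : ℝ), (1 - Real.exp (-x)) * x ^ (-(b + 1))))))) := by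
  set F : ℝ → ℝ := fun x ↦ (1 - Real.exp (-(l * x))) * x ^ (-(b + 1)) with hF
  have h0 : Tendsto (fun n : ℕ ↦ (n : ℝ) ^ (-(1 / b))) atTop (𝓝 0) :=
    (tendsto_rpow_neg_atTop (by positivity)).comp tendsto_natCast_atTop_atTop
  have h1 : Tendsto (fun n : ℕ ↦ ∫ x in Set.Ioi ((n : ℝ) ^ (-(1 / b))), F x) atTop
      (𝓝 (∫ x in Set.Ioi 0, F x)) := by
    have h2 := (aecover_Ioi_of_Ioi (μ := volume) (A := (0 : ℝ))
      h0).integral_tendsto_of_countably_generated (integrableOn_one_sub_exp_mul_rpow hb hb1 hl)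
    refine h2.congr fun n ↦ ?_
    rw [Measure.restrict_restrict measurableSet_Ioi, Set.inter_eq_left.2]
    exact Set.Ioi_subset_Ioi (by positivity)
  rw [← integral_one_sub_exp_mul_rpow hb hl]
  -- The scale `r = n ^ (-(1 / b))` gives `r ^ b = 1 / n`, so each factor is `1 - O(1 / n)` and the
  -- power has an exponential limit.
  have h3 : Tendsto (fun n : ℕ ↦ (1 + -(b * (n : ℝ)⁻¹ *
      ∫ x in Set.Ioi ((n : ℝ) ^ (-(1 / b))), F x)) ^ n) atTop
      (𝓝 (Real.exp (-(b * ∫ x in Set.Ioi 0, F x)))) := by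
    refine Real.tendsto_one_add_pow_exp_of_tendsto ?_
    refine (h1.const_mul b).neg.congr' ?_
    filter_upwards [eventually_gt_atTop 0] with n hn
    field_simp
  refine h3.congr' ?_
  filter_upwards [eventually_gt_atTop 0] with n hn
  have hn : (0 : ℝ) < n := by exact_mod_cast hn
  rw [integral_exp_neg_mul_paretoMeasure (by positivity) hb hl, ← Real.rpow_mul hn.le]
  have : -(1 / b) * b = -1 := by field_simp
  rw [this, Real.rpow_neg_one, sub_eq_add_neg]

/-! ### Compactness for Laplace transforms. -/

/-- A pointwise limit of Laplace transforms of measures on `(0, ∞)` which tends to `1` at `0` and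
to `0` at infinity is again the Laplace transform of a measure on `(0, ∞)`. -/
lemma exists_laplace_eq_of_tendsto (μ : ℕ → Measure ℝ) [∀ n, IsProbabilityMeasure (μ n)]
    (hμ : ∀ n, ∀ᵐ x ∂(μ n), 0 < x) {f : ℝ → ℝ}
    (hf : ∀ l, 0 < l → Tendsto (fun n ↦ ∫ x, Real.exp (-(l * x)) ∂(μ n)) atTop (𝓝 (f l)))
    (hf0 : Tendsto f (𝓝[>] 0) (𝓝 1)) (hf1 : Tendsto f atTop (𝓝 0)) :
    ∃ σ : Measure ℝ, IsProbabilityMeasure σ ∧ (∀ᵐ x ∂σ, 0 < x) ∧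
      ∀ l, 0 < l → ∫ x, Real.exp (-(l * x)) ∂σ = f l := by
  -- The map `x ↦ exp (-x)` carries the measures to the compact space `[0, 1]`, where Laplace
  -- transforms become moments `∫ x ^ l`; `projIcc` only makes it total.
  set φ : ℝ → unitInterval := fun x ↦ Set.projIcc 0 1 zero_le_one (Real.exp (-x)) with hφ
  have hφm : Measurable φ := (continuous_projIcc.comp (by fun_prop)).measurable
  have hφv : ∀ x, 0 < x → ((φ x : unitInterval) : ℝ) = Real.exp (-x) := by
    intro x hx
    rw [hφ]
    simp only
    rw [Set.projIcc_of_mem zero_le_one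
      ⟨Real.exp_nonneg _, Real.exp_le_one_iff.2 (by linarith)⟩]
  let P : ℕ → ProbabilityMeasure unitInterval := fun n ↦
    ⟨(μ n).map φ, Measure.isProbabilityMeasure_map hφm.aemeasurable⟩
  obtain ⟨κ, -, hκ⟩ := isCompact_univ (X := ProbabilityMeasure unitInterval)
    (f := map P atTop) (by simp)
  obtain ⟨U, hU, hUκ⟩ := (mapClusterPt_iff_ultrafilter).1 hκ
  have hcont : ∀ l : ℝ, 0 < l → Continuous (fun x : unitInterval ↦ (x : ℝ) ^ l) := fun l hl ↦
    continuous_subtype_val.rpow_const fun _ ↦ Or.inr hl.le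
  have hpow : ∀ l, 0 < l → ∫ x : unitInterval, (x : ℝ) ^ l ∂κ = f l := by
    intro l hl
    have h1 := (ProbabilityMeasure.tendsto_iff_forall_integral_tendsto.1 hUκ)
      (BoundedContinuousFunction.mkOfCompact ⟨_, hcont l hl⟩)
    refine tendsto_nhds_unique h1 (((hf l hl).mono_left hU).congr fun n ↦ ?_)
    change _ = ∫ x : unitInterval, (x : ℝ) ^ l ∂((μ n).map φ)
    rw [integral_map hφm.aemeasurable (hcont l hl).aestronglyMeasurable]
    refine integral_congr_ae ?_
    filter_upwards [hμ n] with x hx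
    rw [hφv x hx, ← Real.exp_mul]
    ring_nf
  have hbd : ∀ l : ℝ, 0 < l → ∀ x : unitInterval, ‖(x : ℝ) ^ l‖ ≤ 1 := fun l hl x ↦ by
    rw [Real.norm_of_nonneg (Real.rpow_nonneg x.2.1 _)]
    exact Real.rpow_le_one x.2.1 x.2.2 hl.le
  -- An atom at `0` would be mass escaped to infinity. As `l ↓ 0`, `x ^ l` tends to the indicator of
  -- `x ≠ 0`, so `hf0` excludes it.
  have hzero : ∀ᵐ x ∂(κ : Measure unitInterval), x ≠ 0 := by
    have h1 : Tendsto (fun l : ℝ ↦ ∫ x : unitInterval, (x : ℝ) ^ l ∂κ) (𝓝[>] 0)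
        (𝓝 (∫ x : unitInterval, Set.indicator {x | x ≠ 0} 1 x ∂κ)) := by
      refine tendsto_integral_filter_of_dominated_convergence (fun _ ↦ 1) ?_ ?_
        (integrable_const _) (ae_of_all _ fun x ↦ ?_)
      · filter_upwards [self_mem_nhdsWithin] with l hl using (hcont l hl).aestronglyMeasurable
      · filter_upwards [self_mem_nhdsWithin] with l hl using ae_of_all _ (hbd l hl)
      · by_cases hx : x = 0
        · refine tendsto_const_nhds.congr' ?_
          filter_upwards [self_mem_nhdsWithin] with l hl
          simp [hx, Real.zero_rpow (ne_of_gt (show 0 < l from hl))]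
        · have hx' : (x : ℝ) ≠ 0 := fun h ↦ hx (Subtype.ext h)
          have := ((Real.continuousAt_const_rpow hx' (b := 0)).tendsto).mono_left
            (nhdsWithin_le_nhds (s := Set.Ioi 0))
          simpa [hx] using this
    have hms : MeasurableSet {x : unitInterval | x ≠ 0} := measurableSet_eq.compl
    rw [integral_indicator_one hms] at h1
    have h2 := tendsto_nhds_unique h1 (hf0.congr' (by
      filter_upwards [self_mem_nhdsWithin] with l hl using (hpow l hl).symm))
    exact (prob_compl_eq_zero_iff hms).2 (by
      rw [← ENNReal.toReal_eq_one_iff]; exact h2)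
  -- An atom at `1` would be mass collapsed to the origin; it is the limit of the moments as `l →
  -- ∞`, which is `0`.
  have hone : ∀ᵐ x ∂(κ : Measure unitInterval), x ≠ 1 := by
    have h1 : Tendsto (fun l : ℝ ↦ ∫ x : unitInterval, (x : ℝ) ^ l ∂κ) atTop
        (𝓝 (∫ x : unitInterval, Set.indicator {1} 1 x ∂κ)) := by
      refine tendsto_integral_filter_of_dominated_convergence (fun _ ↦ 1) ?_ ?_
        (integrable_const _) (ae_of_all _ fun x ↦ ?_)
      · filter_upwards [eventually_gt_atTop 0] with l hl using (hcont l hl).aestronglyMeasurable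
      · filter_upwards [eventually_gt_atTop 0] with l hl using ae_of_all _ (hbd l hl)
      · by_cases hx : x = 1
        · simp [hx]
        · have hx' : (x : ℝ) < 1 := lt_of_le_of_ne x.2.2 fun h ↦ hx (Subtype.ext h)
          simpa [hx] using tendsto_rpow_atTop_of_base_lt_one (x : ℝ) (by linarith [x.2.1]) hx'
    rw [integral_indicator_one (measurableSet_singleton 1)] at h1
    have h2 := tendsto_nhds_unique h1 (hf1.congr' (by
      filter_upwards [eventually_gt_atTop 0] with l hl using (hpow l hl).symm))
    rw [ae_iff]
    simpa [Measure.real, ENNReal.toReal_eq_zero_iff, measure_ne_top] using h2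
  have hlog : Measurable (fun x : unitInterval ↦ -Real.log x) := by fun_prop
  refine ⟨(κ : Measure unitInterval).map (fun x : unitInterval ↦ -Real.log x),
    Measure.isProbabilityMeasure_map hlog.aemeasurable, ?_, fun l hl ↦ ?_⟩
  · rw [ae_map_iff hlog.aemeasurable measurableSet_Ioi]
    filter_upwards [hzero, hone] with x h0 h1
    have h0' : 0 < (x : ℝ) := lt_of_le_of_ne x.2.1 fun h ↦ h0 (Subtype.ext h.symm)
    have h1' : (x : ℝ) < 1 := lt_of_le_of_ne x.2.2 fun h ↦ h1 (Subtype.ext h)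
    linarith [Real.log_neg h0' h1']
  · rw [integral_map hlog.aemeasurable (by fun_prop), ← hpow l hl]
    refine integral_congr_ae ?_
    filter_upwards [hzero] with x h0
    have h0' : 0 < (x : ℝ) := lt_of_le_of_ne x.2.1 fun h ↦ h0 (Subtype.ext h.symm)
    rw [Real.rpow_def_of_pos h0']
    ring_nf

/-! ### Existence of the one-sided stable law. -/

/-- The one-sided `b`-stable law: a measure on `(0, ∞)` with Laplace transform `exp (-l ^ b)`. -/
lemma exists_laplace_exp_neg_rpow {b : ℝ} (hb : 0 < b) (hb1 : b ≤ 1) :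
    ∃ σ : Measure ℝ, IsProbabilityMeasure σ ∧ (∀ᵐ u ∂σ, 0 < u) ∧
      ∀ l, 0 ≤ l → ∫ u, Real.exp (-(l * u)) ∂σ = Real.exp (-l ^ b) := by
  rcases hb1.eq_or_lt with rfl | hb1
  -- For `b = 1`, that is `α = 2`, the Lévy integral diverges at `0`, but the law is simply a point
  -- mass.
  · refine ⟨Measure.dirac 1, inferInstance, ?_, fun l _ ↦ by simp⟩
    rw [ae_dirac_iff measurableSet_Ioi]
    exact zero_lt_one
  set C : ℝ := b * ∫ x in Set.Ioi (0 : ℝ), (1 - Real.exp (-x)) * x ^ (-(b + 1)) with hC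
  have hC0 : 0 < C := mul_pos hb (integral_one_sub_exp_mul_rpow_pos hb hb1)
  -- The shift to `n + 1` keeps the scale positive and the sum nonempty.
  set r : ℕ → ℝ := fun n ↦ ((n + 1 : ℕ) : ℝ) ^ (-(1 / b)) with hr
  have hr0 : ∀ n, 0 < r n := fun n ↦ by positivity
  have hprob : ∀ n, IsProbabilityMeasure (paretoMeasure (r n) b) := fun n ↦
    isProbabilityMeasure_paretoMeasure (hr0 n) hb
  have hsum : ∀ n : ℕ, Measurable (fun x : Fin (n + 1) → ℝ ↦ ∑ i, x i) := fun n ↦ by fun_prop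
  set μ : ℕ → Measure ℝ := fun n ↦
    (Measure.pi fun _ : Fin (n + 1) ↦ paretoMeasure (r n) b).map (fun x ↦ ∑ i, x i) with hμ
  have hμp : ∀ n, IsProbabilityMeasure (μ n) := fun n ↦
    Measure.isProbabilityMeasure_map (hsum n).aemeasurable
  have hpos : ∀ n, ∀ᵐ x ∂(μ n), 0 < x := by
    intro n
    rw [hμ, ae_map_iff (hsum n).aemeasurable measurableSet_Ioi]
    have h : ∀ᵐ x ∂(Measure.pi fun _ : Fin (n + 1) ↦ paretoMeasure (r n) b), ∀ i, 0 < x i :=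
      ae_all_iff.2 fun i ↦ (Measure.quasiMeasurePreserving_eval _ i).ae
        (ae_paretoMeasure_pos (hr0 n))
    filter_upwards [h] with x hx
    exact Finset.sum_pos (fun i _ ↦ hx i) Finset.univ_nonempty
  have hlap : ∀ l, 0 < l → Tendsto (fun n ↦ ∫ x, Real.exp (-(l * x)) ∂(μ n)) atTop
      (𝓝 (Real.exp (-(C * l ^ b)))) := by
    intro l hl
    have h := (tendsto_integral_exp_paretoMeasure_pow hb hb1 hl.le).comp (tendsto_add_atTop_nat 1)
    have hlim : b * (l ^ b * ∫ x in Set.Ioi (0 : ℝ), (1 - Real.exp (-x)) * x ^ (-(b + 1))) =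
        C * l ^ b := by rw [hC]; ring
    rw [hlim] at h
    refine h.congr fun n ↦ ?_
    rw [hμ, integral_map (hsum n).aemeasurable (by fun_prop)]
    simp_rw [Finset.mul_sum, ← Finset.sum_neg_distrib, Real.exp_sum]
    rw [integral_fintype_prod_eq_pow (fun x ↦ Real.exp (-(l * x))), Fintype.card_fin]
    rfl
  have hcont : Continuous fun l : ℝ ↦ Real.exp (-(C * l ^ b)) := by
    have := Real.continuous_rpow_const hb.le
    fun_prop
  obtain ⟨σ, hσ, hσ0, hσL⟩ := exists_laplace_eq_of_tendsto μ hpos hlap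
    (by
      have h := (hcont.tendsto 0).mono_left (nhdsWithin_le_nhds (s := Set.Ioi 0))
      simpa [Real.zero_rpow hb.ne'] using h)
    (Real.tendsto_exp_neg_atTop_nhds_zero.comp
      ((tendsto_rpow_atTop hb).const_mul_atTop hC0))
  -- The limit has transform `exp (-(C * l ^ b))`; rescaling by `C ^ (-(1 / b))` removes `C`.
  have hm : Measurable fun u : ℝ ↦ C ^ (-(1 / b)) * u := by fun_prop
  refine ⟨σ.map fun u ↦ C ^ (-(1 / b)) * u, Measure.isProbabilityMeasure_map hm.aemeasurable, ?_,
    fun l hl ↦ ?_⟩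
  · rw [ae_map_iff hm.aemeasurable measurableSet_Ioi]
    filter_upwards [hσ0] with u hu
    positivity
  · rw [integral_map hm.aemeasurable (by fun_prop)]
    rcases hl.eq_or_lt with rfl | hl
    · simp [Real.zero_rpow hb.ne']
    simp_rw [← mul_assoc]
    rw [hσL _ (by positivity), Real.mul_rpow hl.le (by positivity), ← Real.rpow_mul hC0.le]
    have : -(1 / b) * b = -1 := by field_simp
    rw [this, Real.rpow_neg_one]
    congr 2
    field_simp

/-! ### Densities and the transition law. -/

/-- The function `(1 + ‖ξ‖ ^ α) ^ (-t)` is the characteristic function of an absolutely continuous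
probability measure. -/
lemma exists_charFun_eq_one_add_norm_rpow (E : Type*) [NormedAddCommGroup E]
    [InnerProductSpace ℝ E] [FiniteDimensional ℝ E] [MeasurableSpace E] [BorelSpace E]
    {α t : ℝ} (hα₀ : 0 < α) (hα₂ : α ≤ 2) (ht : 0 < t) :
    ∃ ν : Measure E, IsProbabilityMeasure ν ∧ ν ≪ volume ∧
      ∀ ξ, charFun ν ξ = (((1 + ‖ξ‖ ^ α) ^ (-t) : ℝ) : ℂ) := by
  obtain ⟨σ, _, hσ0, hσL⟩ := exists_laplace_exp_neg_rpow (half_pos hα₀) (by linarith)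
  obtain ⟨m, _, hm0, hmL⟩ := exists_laplace_one_add_rpow (half_pos hα₀) ht σ hσ0 hσL
  refine ⟨_, Measure.isProbabilityMeasure_map (by fun_prop),
    map_sqrt_smul_stdGaussian_absolutelyContinuous m hm0, fun ξ ↦ ?_⟩
  rw [charFun_map_sqrt_smul_stdGaussian m hm0, hmL _ (by positivity), ← Real.rpow_natCast,
    ← Real.rpow_mul (norm_nonneg ξ)]
  congr 4
  push_cast
  ring

lemma exists_density_charFun_eq_one_add_norm_rpow (E : Type*) [NormedAddCommGroup E]
    [InnerProductSpace ℝ E] [FiniteDimensional ℝ E] [MeasurableSpace E] [BorelSpace E]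
    {α t : ℝ} (hα₀ : 0 < α) (hα₂ : α ≤ 2) (ht : 0 < t) :
    ∃ q : E → ℝ, Measurable q ∧ (∀ y, 0 ≤ q y) ∧
      IsProbabilityMeasure (volume.withDensity (fun y ↦ ENNReal.ofReal (q y))) ∧
      ∀ ξ, charFun (volume.withDensity (fun y ↦ ENNReal.ofReal (q y))) ξ =
        (((1 + ‖ξ‖ ^ α) ^ (-t) : ℝ) : ℂ) := by
  obtain ⟨ν, hν, hac, hchar⟩ := exists_charFun_eq_one_add_norm_rpow E hα₀ hα₂ ht
  have h : volume.withDensity (fun y ↦ ENNReal.ofReal (ν.rnDeriv volume y).toReal) = ν := by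
    -- Passing to a real-valued density loses nothing, since the Radon–Nikodym derivative is finite
    -- almost everywhere.
    rw [withDensity_congr_ae (g := ν.rnDeriv volume), Measure.withDensity_rnDeriv_eq _ _ hac]
    filter_upwards [Measure.rnDeriv_lt_top ν volume] with y hy using ENNReal.ofReal_toReal hy.ne
  refine ⟨fun y ↦ (ν.rnDeriv volume y).toReal, by fun_prop, fun _ ↦ ENNReal.toReal_nonneg, ?_⟩
  rw [h]
  exact ⟨hν, hchar⟩

lemma map_const_add_withDensity {E : Type*} [NormedAddCommGroup E] [MeasurableSpace E]
    [BorelSpace E] (μ : Measure E) [μ.IsAddLeftInvariant] (f : E → ℝ≥0∞) (x : E) :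
    (μ.withDensity f).map (x + ·) = μ.withDensity (fun y ↦ f (y - x)) := by
  ext s hs
  have hx : Measurable fun y : E ↦ x + y := measurable_const_add x
  rw [Measure.map_apply hx hs, withDensity_apply _ (hx hs), withDensity_apply _ hs,
    ← (measurePreserving_add_left μ x).setLIntegral_comp_preimage_emb
      (MeasurableEquiv.addLeft x).measurableEmbedding (fun y ↦ f (y - x)) s]
  simp

theorem theorem3p4 (d : ℕ) (hd : 1 ≤ d) (α : ℝ) (hα₀ : 0 < α) (hα₂ : α ≤ 2) :
    -- there are Borel functions `p t ≥ 0`, `t > 0`, such that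
    (∃ p : ℝ≥0 → EuclideanSpace ℝ (Fin d) → ℝ,
      (∀ t, 0 < t → Measurable (p t) ∧ (∀ y, 0 ≤ p t y)) ∧
      -- `p t (y) dy` is a probability measure with Fourier transform `(1 + |ξ|^α)^(-t)`,
      (∀ t, 0 < t →
        IsProbabilityMeasure (volume.withDensity (fun y ↦ ENNReal.ofReal (p t y))) ∧
        ∀ ξ, charFun (volume.withDensity (fun y ↦ ENNReal.ofReal (p t y))) ξ =
          (((1 + ‖ξ‖ ^ α) ^ (-(t : ℝ)) : ℝ) : ℂ)) ∧
      -- and `p t (y - x)` is the transition density of every geometric `α`-stable process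
      (∀ (Ω : Type*) [MeasurableSpace Ω] (P : Measure Ω)
        (L : ℝ≥0 → Ω → EuclideanSpace ℝ (Fin d)), IsGeometricStableProcess α L P →
        ∀ t, 0 < t → ∀ x : EuclideanSpace ℝ (Fin d),
          P.map (fun ω ↦ x + L t ω) =
            volume.withDensity (fun y ↦ ENNReal.ofReal (p t (y - x))))) ∧
    -- for small `t` the characteristic function is not integrable
    (∀ t : ℝ≥0, 0 < t → (t : ℝ) ≤ d / α →
      ¬ Integrable (fun ξ : EuclideanSpace ℝ (Fin d) ↦ (1 + ‖ξ‖ ^ α) ^ (-(t : ℝ)))) := by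
  have : NeZero d := ⟨by omega⟩
  constructor
  -- The densities are chosen from `t` alone, so one `p` serves every process and starting point.
  · choose! p hpm hp0 hpp hpc using fun (t : ℝ≥0) (ht : 0 < t) ↦
      exists_density_charFun_eq_one_add_norm_rpow (EuclideanSpace ℝ (Fin d)) hα₀ hα₂
        (NNReal.coe_pos.2 ht)
    refine ⟨p, fun t ht ↦ ⟨hpm t ht, hp0 t ht⟩, fun t ht ↦ ⟨hpp t ht, hpc t ht⟩, ?_⟩
    intro Ω _ P L hL t ht x
    have := hL.isLevyProcess.isProbabilityMeasure
    have hLm := hL.isLevyProcess.measurable t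
    have := hpp t ht
    have hlaw : P.map (L t) = volume.withDensity (fun y ↦ ENNReal.ofReal (p t y)) := by
      refine Measure.ext_of_charFun (funext fun ξ ↦ ?_)
      have hpos : 0 < 1 + ‖ξ‖ ^ α := by positivity
      rw [hL.hasSymbol, hpc t ht, Real.rpow_def_of_pos hpos]
      simp only [geometricStableSymbol]
      push_cast
      ring_nf
    rw [← map_const_add_withDensity volume (fun y ↦ ENNReal.ofReal (p t y)), ← hlaw, Measure.map_map (measurable_const_add x) hLm]
    rfl
  · intro t ht htd
    exact not_integrable_one_add_norm_rpow hα₀ t.2 (by simpa using htd)
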